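/- **Setting.** Let $S,A$ be finite nonempty sets, $R\subset\mathbb R_{\ge 0}$ a finite set, $\gamma\in(0,1)$, and for each $(s,a)\in S\times A$ let $\nu_{s,a}$ be a probability distribution on $R$ and $p_{s,a}$ a probability distribution on $S$. For $Q:S\times A\to\mathbb R$ put $v(Q)(s)=\max_{b\in A}Q(s,b)$. For $\delta>0$ the distributionally robust (DR) Bellman operator is $$\mathcal T_\delta(Q)(s,a)=\inf\Big\{\mathbb E_{r\sim\nu}[r]+\gamma\,\mathbb E_{s'\sim p}[v(Q)(s')]\;:\;D_{\mathrm{KL}}(p\,\|\,p_{s,a})\le\delta,\ D_{\mathrm{KL}}(\nu\,\|\,\nu_{s,a})\le\delta\Big\}.$$ For a probability measure $\mu$ and a function $u$ on a finite set write $$F_\delta(\mu,u)=\sup_{\alpha\ge0}\Big\{-\alpha\log\mathbb E_{\mu}\big[e^{-u/\alpha}\big]-\alpha\delta\Big\},$$ where the expression at $\alpha=0$ means its limit $\operatorname{ess\,inf}_\mu u$. The dual form of the operator is $F_\delta(\nu_{s,a},\mathrm{id})+\gamma F_\delta(p_{s,a},v(Q))$. **Estimator.** Let $g\in(0,1)$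 and $p_n=g(1-g)^n$, $n\ge0$. For each $(s,a)$ draw independently $N_1,N_2$ with $\mathbb P(N_j=n)=p_n$, i.i.d. samples $r_1,r_2,\dots\sim\nu_{s,a}$ and i.i.d. samples $s_1',s_2',\dots\sim p_{s,a}$ (only the first $2^{N_1+1}$, respectively $2^{N_2+1}$, are used). For samples $x_1,x_2,\dots$ and a function $u$ let $$\Delta_n(x,u)=F_\delta(\mu_{2^{n+1}},u)-\tfrac12F_\delta(\mu^E_{2^n},u)-\tfrac12F_\delta(\mu^O_{2^n},u),$$ where $\mu_{2^{n+1}}$ is the empirical distribution of $x_1,\dots,x_{2^{n+1}}$ and $\mu^E_{2^n}$, $\mu^O_{2^n}$ are those of its even- and odd-indexed members. The multilevel Monte Carlo DR estimator is $$\widehat{\mathcal T}_{\delta,g}(Q)(s,a)=r_1+\frac{\Delta_{N_1}(r,\mathrm{id})}{p_{N_1}}+\gamma\Big(v(Q)(s_1')+\frac{\Delta_{N_2}(s',v(Q))}{p_{N_2}}\Big),$$ and $W(Q)=\widehat{\mathcal T}_{\delta,g}(Q)-\mathcal T_\delta(Q)$. **Proposition.** Let $p_\wedge$ be the smallest of all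 positive values $\nu_{s,a}(r)$ and $p_{s,a}(s')$, over $s,s'\in S$, $a\in A$, $r\in R$. Assume $\delta>0$, $\tfrac12p_\wedge\ge1-e^{-\delta}$ and $g\in(0,3/4)$. Then for every fixed $Q:S\times A\to\mathbb R$ the random vector $\widehat{\mathcal T}_{\delta,g}(Q)$ is integrable and is an unbiased estimator of $\mathcal T_\delta(Q)$, in its primal and in its dual form: $\mathbb E\,\widehat{\mathcal T}_{\delta,g}(Q)=\mathcal T_\delta(Q)$, i.e. $\mathbb E\,W(Q)=0$. -/

import Mathlib

open MeasureTheory ProbabilityTheory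

noncomputable section

namespace DRQ

/-- A finite Markov decision process with state space `S`, action space `A`, a finite reward space
`rewards ⊆ ℝ≥0`, reward laws `ν s a`, transition laws `p s a` and a discount factor `γ ∈ (0,1)`. -/
structure MDP (S A : Type*) where
  rewards : Finset ℝ
  rewards_nonneg : ∀ r ∈ rewards, 0 ≤ r
  ν : S → A → PMF rewards
  p : S → A → PMF S
  γ : ℝ
  γ_pos : 0 < γ
  γ_lt_one : γ < 1

/-- The set of probability measures within Kullback-Leibler divergence `δ` of `μ`. -/
def klBall {Y : Type*} [MeasurableSpace Y] (δ : ℝ) (μ : Measure Y) : Set (Measure Y) :=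
  {q | IsProbabilityMeasure q ∧ InformationTheory.klDiv q μ ≤ ENNReal.ofReal δ}

/-- The dual objective `-α log E_μ[exp(-u/α)] - αδ`. At `α = 0` it is understood as its limit,
the `μ`-essential infimum of `u`. -/
def dualObjective {Y : Type*} [MeasurableSpace Y] (δ : ℝ) (μ : Measure Y) (u : Y → ℝ) (α : ℝ) : ℝ :=
  if α = 0 then essInf u μ
  else -α * Real.log (∫ y, Real.exp (-u y / α) ∂μ) - α * δ

/-- The dual value: the supremum over `α ≥ 0` of the dual objective. -/
def dualValue {Y : Type*} [MeasurableSpace Y] (δ : ℝ) (μ : Measure Y) (u : Y → ℝ) : ℝ :=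
  sSup (dualObjective δ μ u '' Set.Ici 0)

/-- The empirical distribution of the finite sequence `x 0, …, x (n-1)`. -/
def empirical {Y : Type*} [MeasurableSpace Y] (n : ℕ) (x : ℕ → Y) : Measure Y :=
  (n : ENNReal)⁻¹ • ∑ j ∈ Finset.range n, Measure.dirac (x j)

/-- The level-`n` difference built from the first `2^(n+1)` samples. The samples are numbered from
`0`, so the first, third, … sample (the odd ones) are `x 0, x 2, …`, and the second, fourth, …
sample (the even ones) are `x 1, x 3, …`. -/
def levelDiff {Y : Type*} [MeasurableSpace Y] (δ : ℝ) (u : Y → ℝ) (n : ℕ) (x : ℕ → Y) : ℝ :=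
  dualValue δ (empirical (2 ^ (n + 1)) x) u
    - 1 / 2 * dualValue δ (empirical (2 ^ n) (fun j => x (2 * j + 1))) u
    - 1 / 2 * dualValue δ (empirical (2 ^ n) (fun j => x (2 * j))) u

/-- The weight `p_n = g (1-g)^n` of the geometric distribution on `{0, 1, 2, …}`. -/
def geoWeight (g : unitInterval) (n : ℕ) : ℝ := (g : ℝ) * (1 - (g : ℝ)) ^ n

/-- The randomized multilevel estimator from the level `n` and the samples `x`. -/
def mlmc {Y : Type*} [MeasurableSpace Y] (δ : ℝ) (g : unitInterval) (u : Y → ℝ)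
    (n : ℕ) (x : ℕ → Y) : ℝ :=
  u (x 0) + levelDiff δ u n x / geoWeight g n

/-- The greedy value `v(Q)(s) = max_b Q(s,b)`. -/
def greedyValue {S A : Type*} (Q : S × A → ℝ) (s : S) : ℝ := ⨆ b : A, Q (s, b)

namespace MDP

variable {S A : Type*} (M : MDP S A)

/-- The minimal support probability. -/
def minSupportProb : ℝ :=
  (⨅ (s : S) (a : A), (⨅ r ∈ (M.ν s a).support, M.ν s a r) ⊓
    (⨅ s' ∈ (M.p s a).support, M.p s a s')).toReal

/-- The primal form of the distributionally robust Bellman operator. -/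
def drBellman [MeasurableSpace S] (δ : ℝ) (Q : S × A → ℝ) : S × A → ℝ := fun z =>
  sInf {x | ∃ q ∈ klBall δ (M.p z.1 z.2).toMeasure, ∃ ρ ∈ klBall δ (M.ν z.1 z.2).toMeasure,
    x = (∫ r, (r : ℝ) ∂ρ) + M.γ * ∫ s', greedyValue Q s' ∂q}

/-- The dual form of the distributionally robust Bellman operator. -/
def drBellmanDual [MeasurableSpace S] (δ : ℝ) (Q : S × A → ℝ) : S × A → ℝ := fun z =>
  dualValue δ (M.ν z.1 z.2).toMeasure (fun r => (r : ℝ))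
    + M.γ * dualValue δ (M.p z.1 z.2).toMeasure (greedyValue Q)

/-- The randomness used at one state-action pair: the levels `N₁, N₂`, the reward samples and the
next-state samples. Only the first `2^(N₁+1)` and `2^(N₂+1)` samples are ever used. -/
abbrev Draw : Type _ := ℕ × ℕ × (ℕ → M.rewards) × (ℕ → S)

/-- The law of the draw at `(s,a)`: `N₁, N₂ ∼ Geo(g)`, i.i.d. rewards from `ν s a` and i.i.d. next
states from `p s a`, all independent. -/
def drawLaw [MeasurableSpace S] (g : unitInterval) (s : S) (a : A) : Measure M.Draw :=
  (geometricMeasure g).prod ((geometricMeasure g).prod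
    ((Measure.infinitePi fun _ : ℕ => (M.ν s a).toMeasure).prod
      (Measure.infinitePi fun _ : ℕ => (M.p s a).toMeasure)))

/-- The MLMC-DR estimator, as a function of the draws at all state-action pairs. -/
def mlmcEstimator [MeasurableSpace S] (δ : ℝ) (g : unitInterval) (Q : S × A → ℝ)
    (d : S × A → M.Draw) : S × A → ℝ := fun z =>
  mlmc δ g (fun r : M.rewards => (r : ℝ)) (d z).1 (d z).2.2.1
    + M.γ * mlmc δ g (greedyValue Q) (d z).2.1 (d z).2.2.2

/-- The noise `W(Q)`: the estimator minus the distributionally robust Bellman operator. -/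
def noise [MeasurableSpace S] (δ : ℝ) (g : unitInterval) (Q : S × A → ℝ)
    (d : S × A → M.Draw) : S × A → ℝ :=
  M.mlmcEstimator δ g Q d - M.drBellman δ Q

end MDP

end DRQ

end

/-!
Unbiasedness of the randomized multilevel estimator is a telescoping argument. By exchangeability
the even and the odd half of the samples have the law of a fresh sample, so the level difference
`Δ_n` has mean `E F(μ_{2^(n+1)}) - E F(μ_{2^n})` (`integral_levelDiff`), and dividing by the weight
`p_N` of the random level turns the series of these means into an expectation
(`integrable_integral_mlmc`). Its sum is `F(μ) - E F(μ_1)`, and `F(μ_1) = u(x_1)` because the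
empirical distribution of one sample is a point mass (`dualValue_dirac`); the first term of the
estimator cancels this contribution.

What has to be proved is the absolute convergence `∑ E|Δ_n| < ∞`. It follows from a Lipschitz
property of the dual value (`dualValue_le_add`, `abs_dualValue_sub_le`): multipliers
`α > (max u - min u) / δ` never beat `α = 0`, and for bounded `α` the map
`μ ↦ -α log E_μ exp(-u/α)` changes by at most `α ε` if `μ` is replaced by `μ' ≤ (1 + ε) μ`. The
empirical distribution is almost surely supported in the support of `μ`, and each of its masses has
mean error at most `1 / √n`, hence `E|Δ_n| = O(2^(-n/2))`.

The primal and the dual form of the operator agree by strong duality on a finite space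
(`isGLB_integral_klBall`). One inequality is the Gibbs variational principle. For the other,
consider the exponential tilts of `μ` by `-β u`, whose relative entropy `tiltEntropy` is continuous
in `β` and vanishes at `0`: either it takes the value `δ`, and the corresponding tilt attains the
dual objective at `α = 1 / β`, or every tilt lies in the ball, and letting `β → ∞` gives the minimum
of `u` over the support, which is the dual objective at `α = 0`.
-/

open MeasureTheory ProbabilityTheory

noncomputable section

namespace DRQ

/-! ### The dual value on a finite space -/

section FiniteSpace

variable {Y : Type*} [Fintype Y] [MeasurableSpace Y] [DiscreteMeasurableSpace Y]

/-- On a finite space the essential infimum is the minimum over the support. -/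
lemma exists_essInf_eq {Y : Type*} [Fintype Y] [MeasurableSpace Y] (μ : Measure Y)
    [IsProbabilityMeasure μ] (u : Y → ℝ) :
    ∃ y, μ {y} ≠ 0 ∧ essInf u μ = u y ∧ ∀ z, μ {z} ≠ 0 → u y ≤ u z := by
  classical
  have hne : (Finset.univ.filter fun y => μ {y} ≠ 0).Nonempty := by
    by_contra h
    rw [Finset.not_nonempty_iff_eq_empty, Finset.filter_eq_empty_iff] at h
    have h0 : μ = 0 := by
      refine Measure.ext_of_singleton fun y => ?_
      simpa using h (Finset.mem_univ y)
    exact IsProbabilityMeasure.ne_zero μ h0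
  obtain ⟨y, hy, hmin⟩ := Finset.exists_min_image _ u hne
  simp only [Finset.mem_filter, Finset.mem_univ, true_and] at hy hmin
  refine ⟨y, hy, ?_, hmin⟩
  rw [essInf_eq_sSup]
  have : {a | μ {x | u x < a} = 0} = Set.Iic (u y) := by
    ext a
    simp only [Set.mem_ofPred_eq, Set.mem_Iic]
    constructor
    · intro h
      by_contra! hlt
      exact hy (measure_mono_null (by simpa using hlt) h)
    · intro h
      rw [measure_null_iff_singleton (Set.to_countable _)]
      intro z hz
      by_contra hz0
      exact absurd (hmin z hz0) (not_le.2 (lt_of_lt_of_le hz h))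
  rw [this, csSup_Iic]

lemma integral_exp_pos_of_finite (μ : Measure Y) [IsProbabilityMeasure μ] (f : Y → ℝ) :
    0 < ∫ y, Real.exp (f y) ∂μ :=
  integral_exp_pos .of_finite

variable {μ μ' : Measure Y} [IsProbabilityMeasure μ] [IsProbabilityMeasure μ'] {u : Y → ℝ}
  {δ m M : ℝ}

lemma dualObjective_le (hM : ∀ y, u y ≤ M) {α : ℝ} (hα : 0 ≤ α) :
    dualObjective δ μ u α ≤ M - α * δ := by
  unfold dualObjective
  split_ifs with h
  · obtain ⟨y, -, hy, -⟩ := exists_essInf_eq μ u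
    simpa [h, hy] using hM y
  · have hα : 0 < α := lt_of_le_of_ne hα (Ne.symm h)
    have h1 : Real.exp (-M / α) ≤ ∫ y, Real.exp (-u y / α) ∂μ := by
      have : ∫ _y, Real.exp (-M / α) ∂μ ≤ ∫ y, Real.exp (-u y / α) ∂μ := by
        refine integral_mono .of_finite .of_finite fun y => ?_
        have := hM y
        simp only
        gcongr
      simpa using this
    have h2 := (Real.le_log_iff_exp_le (integral_exp_pos_of_finite μ _)).2 h1
    rw [div_le_iff₀ hα] at h2
    linarith

lemma bddAbove_dualObjective (hδ : 0 ≤ δ) :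
    BddAbove (dualObjective δ μ u '' Set.Ici 0) := by
  obtain ⟨M, hM⟩ := (Set.finite_range u).bddAbove
  refine ⟨M, ?_⟩
  rintro _ ⟨α, hα, rfl⟩
  have := dualObjective_le (μ := μ) (δ := δ) (fun y => hM ⟨y, rfl⟩) hα
  have : 0 ≤ α * δ := mul_nonneg hα hδ
  linarith

lemma dualObjective_le_dualValue (hδ : 0 ≤ δ) {α : ℝ} (hα : 0 ≤ α) :
    dualObjective δ μ u α ≤ dualValue δ μ u :=
  le_csSup (bddAbove_dualObjective hδ) ⟨α, hα, rfl⟩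

lemma essInf_le_dualValue (hδ : 0 ≤ δ) : essInf u μ ≤ dualValue δ μ u := by
  simpa [dualObjective] using dualObjective_le_dualValue (μ := μ) (u := u) hδ le_rfl

lemma dualValue_le {Y : Type*} [MeasurableSpace Y] {μ : Measure Y} {u : Y → ℝ} {δ b : ℝ}
    (h : ∀ α, 0 ≤ α → dualObjective δ μ u α ≤ b) :
    dualValue δ μ u ≤ b := by
  refine csSup_le (Set.image_nonempty.2 ⟨0, Set.mem_Ici.2 le_rfl⟩) ?_
  rintro _ ⟨α, hα, rfl⟩
  exact h α hα

lemma dualValue_le_of_le (hδ : 0 ≤ δ) (hM : ∀ y, u y ≤ M) : dualValue δ μ u ≤ M :=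
  dualValue_le fun α hα => by
    have := dualObjective_le (μ := μ) (δ := δ) hM hα
    have : 0 ≤ α * δ := mul_nonneg hα hδ
    linarith

lemma le_dualValue_of_le (hδ : 0 ≤ δ) (hm : ∀ y, m ≤ u y) : m ≤ dualValue δ μ u := by
  obtain ⟨y, -, hy, -⟩ := exists_essInf_eq μ u
  exact (hm y).trans (hy ▸ essInf_le_dualValue hδ)

/-- One-sided Lipschitz bound for the dual value. Multipliers `α` above `(M - m) / δ` are never
better than `α = 0`, and for the others replacing `μ` by `μ' ≤ (1 + ε) μ` costs at most
`α log (1 + ε) ≤ α ε`. -/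
lemma dualValue_le_add (hδ : 0 < δ) (hm : ∀ y, m ≤ u y) (hM : ∀ y, u y ≤ M) {ε : ℝ} (hε : 0 ≤ ε)
    (h : ∀ y, μ'.real {y} ≤ (1 + ε) * μ.real {y}) :
    dualValue δ μ u ≤ dualValue δ μ' u + (M - m) / δ * ε := by
  obtain ⟨y', hy', he', hmin'⟩ := exists_essInf_eq μ' u
  have hosc : 0 ≤ (M - m) / δ * ε :=
    mul_nonneg (div_nonneg (sub_nonneg.2 ((hm y').trans (hM y'))) hδ.le) hε
  refine dualValue_le fun α hα => ?_
  rcases hα.eq_or_lt with rfl | hα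
  · obtain ⟨y, hy, he, hmin⟩ := exists_essInf_eq μ u
    have hne : μ {y'} ≠ 0 := by
      intro h0
      have h1 := h y'
      rw [(measureReal_eq_zero_iff).2 h0, mul_zero] at h1
      exact hy' ((measureReal_eq_zero_iff).1 (le_antisymm h1 measureReal_nonneg))
    have : essInf u μ ≤ essInf u μ' := by
      rw [he, he']
      exact hmin y' hne
    have h2 := essInf_le_dualValue (μ := μ') (u := u) hδ.le
    simp only [dualObjective, if_true]
    linarith
  · by_cases hbig : (M - m) / δ ≤ α
    · have h1 := dualObjective_le (μ := μ) (δ := δ) hM hα.le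
      rw [div_le_iff₀ hδ] at hbig
      have h2 := le_dualValue_of_le (μ := μ') (δ := δ) hδ.le hm
      linarith
    · have h1 := dualObjective_le_dualValue (μ := μ') (u := u) hδ.le hα.le
      have h2 : ∫ y, Real.exp (-u y / α) ∂μ' ≤ (1 + ε) * ∫ y, Real.exp (-u y / α) ∂μ := by
        rw [integral_fintype .of_finite, integral_fintype .of_finite, Finset.mul_sum]
        refine Finset.sum_le_sum fun y _ => ?_
        simp only [smul_eq_mul]
        rw [← mul_assoc]
        exact mul_le_mul_of_nonneg_right (h y) (Real.exp_pos _).le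
      have hp := integral_exp_pos_of_finite μ (fun y => -u y / α)
      have hp' := integral_exp_pos_of_finite μ' (fun y => -u y / α)
      have h3 := Real.log_le_log hp' h2
      rw [Real.log_mul (by positivity) hp.ne'] at h3
      have h4 : Real.log (1 + ε) ≤ ε := by
        have := Real.log_le_sub_one_of_pos (show 0 < 1 + ε by positivity)
        linarith
      have h5 : α * Real.log (∫ y, Real.exp (-u y / α) ∂μ')
          ≤ α * (ε + Real.log (∫ y, Real.exp (-u y / α) ∂μ)) := by
        gcongr
        linarith
      have h6 : α * ε ≤ (M - m) / δ * ε := by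
        gcongr
        exact (not_le.1 hbig).le
      simp only [dualObjective, if_neg hα.ne'] at h1 ⊢
      linarith

/-- The dual value is Lipschitz at `μ` along measures supported in the support of `μ`; here `c` is
a lower bound for the positive masses of `μ`. -/
lemma abs_dualValue_sub_le (hδ : 0 < δ) (hm : ∀ y, m ≤ u y) (hM : ∀ y, u y ≤ M) {c : ℝ}
    (hc : 0 < c) (hcμ : ∀ y, μ {y} ≠ 0 → c ≤ μ.real {y}) (hac : ∀ y, μ {y} = 0 → μ' {y} = 0) :
    |dualValue δ μ' u - dualValue δ μ u|
      ≤ (2 * (M - m) / c + 2 * (M - m) / (δ * c)) * ∑ y, |μ'.real {y} - μ.real {y}| := by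
  set η := ∑ y, |μ'.real {y} - μ.real {y}| with hη
  have hη0 : 0 ≤ η := Finset.sum_nonneg fun _ _ => abs_nonneg _
  have hle : ∀ y, |μ'.real {y} - μ.real {y}| ≤ η := fun y =>
    Finset.single_le_sum (f := fun y => |μ'.real {y} - μ.real {y}|) (fun _ _ => abs_nonneg _)
      (Finset.mem_univ y)
  obtain ⟨y₀, -⟩ := exists_essInf_eq μ u
  have hosc : 0 ≤ M - m := sub_nonneg.2 ((hm y₀).trans (hM y₀))
  have hA : 0 ≤ 2 * (M - m) / c * η := by positivity
  have hB : 0 ≤ 2 * (M - m) / (δ * c) * η := by positivity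
  rw [add_mul]
  -- If the distance exceeds `c / 2` the oscillation bound suffices; otherwise the two measures
  -- dominate each other up to the factor `1 + 2 η / c`.
  by_cases hbig : c / 2 ≤ η
  · have h1 : M - m ≤ 2 * (M - m) / c * η := by
      rw [div_mul_eq_mul_div, le_div_iff₀ hc]
      nlinarith
    have a1 := dualValue_le_of_le (μ := μ) (δ := δ) hδ.le hM
    have a2 := dualValue_le_of_le (μ := μ') (δ := δ) hδ.le hM
    have a3 := le_dualValue_of_le (μ := μ) (δ := δ) hδ.le hm
    have a4 := le_dualValue_of_le (μ := μ') (δ := δ) hδ.le hm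
    rw [abs_le]
    constructor <;> linarith
  · push Not at hbig
    have e1 : ∀ y, μ'.real {y} ≤ (1 + 2 * η / c) * μ.real {y} := by
      intro y
      by_cases hy : μ {y} = 0
      · simp [measureReal_def, hy, hac y hy]
      · have h1 := hcμ y hy
        have h2 := (abs_le.1 (hle y)).2
        have h3 : η ≤ η / c * μ.real {y} := by
          rw [div_mul_eq_mul_div, le_div_iff₀ hc]
          gcongr
        have h4 : 2 * η / c * μ.real {y} = 2 * (η / c * μ.real {y}) := by ring
        rw [add_mul, h4]
        linarith
    have e2 : ∀ y, μ.real {y} ≤ (1 + 2 * η / c) * μ'.real {y} := by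
      intro y
      by_cases hy : μ {y} = 0
      · simp [measureReal_def, hy, hac y hy]
      · have h1 := hcμ y hy
        have h2 := (abs_le.1 (hle y)).1
        have h3 : η ≤ 2 * η / c * μ'.real {y} := by
          have h5 : c / 2 ≤ μ'.real {y} := by linarith
          rw [div_mul_eq_mul_div, le_div_iff₀ hc]
          nlinarith
        rw [add_mul]
        linarith
    have hε : 0 ≤ 2 * η / c := by positivity
    have b1 := dualValue_le_add hδ hm hM hε e1
    have b2 := dualValue_le_add hδ hm hM hε e2
    have h7 : (M - m) / δ * (2 * η / c) = 2 * (M - m) / (δ * c) * η := by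
      field_simp
    rw [h7] at b1 b2
    rw [abs_le]
    constructor <;> linarith

/-- The dual value of a point mass does not depend on the radius. -/
lemma dualValue_dirac (hδ : 0 ≤ δ) (u : Y → ℝ) (x : Y) :
    dualValue δ (Measure.dirac x) u = u x := by
  have hess : essInf u (Measure.dirac x) = u x := by
    obtain ⟨y, hy, he, -⟩ := exists_essInf_eq (Measure.dirac x) u
    have : x = y := by
      by_contra hne
      exact hy (by simp [hne])
    rw [he, this]
  refine le_antisymm (dualValue_le fun α hα => ?_) (hess ▸ essInf_le_dualValue hδ)
  unfold dualObjective
  split_ifs with h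
  · exact hess.le
  · have : 0 ≤ α * δ := mul_nonneg hα hδ
    rw [integral_dirac, Real.log_exp]
    have h2 : -α * (-u x / α) = u x := by field_simp
    linarith

end FiniteSpace

/-! ### Strong duality for the Kullback–Leibler ball -/

section Duality

variable {Y : Type*} [Fintype Y] [MeasurableSpace Y] [DiscreteMeasurableSpace Y]
  {μ : Measure Y} [IsProbabilityMeasure μ] {u : Y → ℝ} {δ : ℝ}

/-- The Gibbs variational inequality. -/
lemma dualObjective_le_integral_of_mem_klBall (hδ : 0 ≤ δ) {q : Measure Y}
    (hq : q ∈ klBall δ μ) {α : ℝ} (hα : 0 ≤ α) : dualObjective δ μ u α ≤ ∫ y, u y ∂q := by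
  obtain ⟨hqp, hkl⟩ := hq
  have hfin : InformationTheory.klDiv q μ ≠ ⊤ := ne_top_of_le_ne_top ENNReal.ofReal_ne_top hkl
  obtain ⟨hac, hint⟩ := InformationTheory.klDiv_ne_top_iff.1 hfin
  unfold dualObjective
  split_ifs with h
  · obtain ⟨y, -, he, hmin⟩ := exists_essInf_eq μ u
    have h1 : ∫ _, u y ∂q ≤ ∫ y, u y ∂q := by
      refine integral_mono_ae .of_finite .of_finite (hac.ae_le ?_)
      change ∀ᵐ z ∂μ, u y ≤ u z
      rw [ae_iff, measure_null_iff_singleton (Set.to_countable _)]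
      intro z hz
      by_contra h0
      exact hz (hmin z h0)
    simpa [he] using h1
  · have hα : 0 < α := lt_of_le_of_ne hα (Ne.symm h)
    have hexp : Integrable (fun y => Real.exp (-u y / α)) μ := .of_finite
    have h1 := integral_llr_tilted_right (f := fun y => -u y / α) hac .of_finite hexp hint
    have hprob : IsProbabilityMeasure (μ.tilted fun y => -u y / α) :=
      isProbabilityMeasure_tilted hexp
    have hac' : q ≪ μ.tilted fun y => -u y / α := hac.trans (absolutelyContinuous_tilted hexp)
    have h2 := InformationTheory.toReal_klDiv_of_measure_eq hac' (by simp)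
    have h3 : 0 ≤ (InformationTheory.klDiv q (μ.tilted fun y => -u y / α)).toReal :=
      ENNReal.toReal_nonneg
    have h4 := InformationTheory.toReal_klDiv_of_measure_eq hac (by simp)
    have h5 : (InformationTheory.klDiv q μ).toReal ≤ δ := ENNReal.toReal_le_of_le_ofReal hδ hkl
    have h6 : ∫ y, -u y / α ∂q = -(∫ y, u y ∂q) / α := by
      rw [integral_div, integral_neg]
    rw [h2, h1, ← h4, h6] at h3
    have h7 : 0 ≤ α * ((InformationTheory.klDiv q μ).toReal - -(∫ y, u y ∂q) / α
        + Real.log (∫ y, Real.exp (-u y / α) ∂μ)) := by positivity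
    have h8 : α * (-(∫ y, u y ∂q) / α) = -∫ y, u y ∂q := by field_simp
    have h9 : α * (InformationTheory.klDiv q μ).toReal ≤ α * δ := by gcongr
    rw [mul_add, mul_sub, h8] at h7
    linarith

/-- The relative entropy of the exponential tilt of `μ` by `-β u` with respect to `μ`, written as
`-β E_tilt[u] - log E_μ[exp(-β u)]`; `klDiv_tilted` identifies it with the divergence. -/
def tiltEntropy {Y : Type*} [MeasurableSpace Y] (μ : Measure Y) (u : Y → ℝ) (β : ℝ) : ℝ :=
  -β * ∫ y, u y ∂(μ.tilted fun y => -β * u y) - Real.log (∫ y, Real.exp (-β * u y) ∂μ)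

lemma klDiv_tilted (β : ℝ) :
    InformationTheory.klDiv (μ.tilted fun y => -β * u y) μ ≠ ⊤ ∧
    (InformationTheory.klDiv (μ.tilted fun y => -β * u y) μ).toReal = tiltEntropy μ u β := by
  have hexp : Integrable (fun y => Real.exp (-β * u y)) μ := .of_finite
  have hprob : IsProbabilityMeasure (μ.tilted fun y => -β * u y) :=
      isProbabilityMeasure_tilted hexp
  have hac := tilted_absolutelyContinuous μ (fun y => -β * u y)
  refine ⟨InformationTheory.klDiv_ne_top hac .of_finite, ?_⟩
  rw [InformationTheory.toReal_klDiv_of_measure_eq hac (by rw [measure_univ, measure_univ]),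
    tiltEntropy]
  have h1 := hac.ae_le (log_rnDeriv_tilted_left_self (f := fun y => -β * u y) hexp)
  have h2 : ∫ y, llr (μ.tilted fun y => -β * u y) μ y ∂(μ.tilted fun y => -β * u y)
      = ∫ y, (-β * u y - Real.log (∫ y, Real.exp (-β * u y) ∂μ))
        ∂(μ.tilted fun y => -β * u y) := integral_congr_ae h1
  rw [h2, integral_sub .of_finite .of_finite, integral_const_mul, integral_const,
    probReal_univ, one_smul]

lemma continuous_tiltEntropy : Continuous (tiltEntropy μ u) := by
  have hZ : ∀ β, ∫ y, Real.exp (-β * u y) ∂μ ≠ 0 := fun β =>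
    (integral_exp_pos_of_finite μ _).ne'
  have hZc : Continuous fun β => ∫ y, Real.exp (-β * u y) ∂μ := by
    simp_rw [integral_fintype (Integrable.of_finite (μ := μ) (f := fun y => Real.exp (_ * u y)))]
    fun_prop
  have hI : ∀ β, ∫ y, u y ∂(μ.tilted fun y => -β * u y)
      = ∑ y, μ.real {y} * (Real.exp (-β * u y) / (∫ y, Real.exp (-β * u y) ∂μ) * u y) := by
    intro β
    rw [integral_tilted, integral_fintype .of_finite]
    rfl
  unfold tiltEntropy
  simp_rw [hI]
  refine Continuous.sub (continuous_neg.mul (continuous_finsetSum _ fun y _ => ?_)) (hZc.log hZ)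
  refine continuous_const.mul (Continuous.mul (Continuous.div ?_ hZc hZ) continuous_const)
  fun_prop

lemma tiltEntropy_zero {Y : Type*} [MeasurableSpace Y] {μ : Measure Y} [IsProbabilityMeasure μ]
    {u : Y → ℝ} : tiltEntropy μ u 0 = 0 := by simp [tiltEntropy]

lemma tilted_mem_klBall {β : ℝ} (h : tiltEntropy μ u β ≤ δ) :
    (μ.tilted fun y => -β * u y) ∈ klBall δ μ := by
  refine ⟨isProbabilityMeasure_tilted .of_finite, ?_⟩
  rw [← ENNReal.ofReal_toReal (klDiv_tilted (μ := μ) (u := u) β).1, (klDiv_tilted β).2]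
  exact ENNReal.ofReal_le_ofReal h

lemma self_mem_klBall {Y : Type*} [MeasurableSpace Y] (μ : Measure Y) [IsProbabilityMeasure μ] :
    μ ∈ klBall δ μ :=
  ⟨inferInstance, by simp⟩

/-- Strong duality for the Kullback–Leibler ball on a finite space. Either some exponential tilt of
`μ` has entropy exactly `δ`, and then it attains the dual objective at its own temperature, or all
tilts stay in the ball, and then they concentrate on the minimizers of `u` in the support. -/
theorem isGLB_integral_klBall (hδ : 0 < δ) :
    IsGLB ((fun q : Measure Y => ∫ y, u y ∂q) '' klBall δ μ) (dualValue δ μ u) := by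
  constructor
  · rintro _ ⟨q, hq, rfl⟩
    exact dualValue_le fun α hα => dualObjective_le_integral_of_mem_klBall hδ.le hq hα
  · intro b hb
    have hb' : ∀ β, tiltEntropy μ u β ≤ δ → b ≤ ∫ y, u y ∂(μ.tilted fun y => -β * u y) :=
      fun β hβ => hb ⟨_, tilted_mem_klBall hβ, rfl⟩
    by_cases hex : ∃ β, 0 ≤ β ∧ δ ≤ tiltEntropy μ u β
    · obtain ⟨β₁, hβ₁, hle⟩ := hex
      obtain ⟨β, ⟨hβ0, -⟩, hβ⟩ := intermediate_value_Icc hβ₁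
        (continuous_tiltEntropy (μ := μ) (u := u)).continuousOn
        ⟨tiltEntropy_zero.trans_le hδ.le, hle⟩
      have hβpos : 0 < β := by
        refine lt_of_le_of_ne hβ0 ?_
        rintro rfl
        exact hδ.ne (tiltEntropy_zero.symm.trans hβ)
      have h1 := dualObjective_le_dualValue (μ := μ) (u := u) hδ.le (inv_nonneg.2 hβ0)
      have h2 := hb' β hβ.le
      have h3 : ∀ y, -u y / β⁻¹ = -β * u y := fun y => by rw [div_inv_eq_mul]; ring
      simp only [dualObjective, if_neg (inv_ne_zero hβpos.ne'), h3] at h1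
      refine (h2.trans (le_of_eq ?_)).trans h1
      rw [← hβ, tiltEntropy]
      field_simp
      ring
    · push Not at hex
      obtain ⟨y₀, hy₀, he, -⟩ := exists_essInf_eq μ u
      refine le_trans ?_ (he ▸ essInf_le_dualValue hδ.le)
      have hpos : 0 < μ.real {y₀} := by
        rw [measureReal_def]
        exact ENNReal.toReal_pos hy₀ (measure_ne_top _ _)
      -- The tilted mean is at most `-log Z(β) / β`, and `Z(β)` is at least its term at `y₀`.
      have key : ∀ β : ℝ, 0 < β → b ≤ u y₀ + -Real.log (μ.real {y₀}) * β⁻¹ := by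
        intro β hβ
        have h1 := hb' β (hex β hβ.le).le
        have h2 : 0 ≤ tiltEntropy μ u β :=
          (klDiv_tilted (μ := μ) (u := u) β).2 ▸ ENNReal.toReal_nonneg
        have h3 : μ.real {y₀} * Real.exp (-β * u y₀) ≤ ∫ y, Real.exp (-β * u y) ∂μ := by
          rw [integral_fintype .of_finite]
          exact Finset.single_le_sum (f := fun y => μ.real {y} • Real.exp (-β * u y))
            (fun _ _ => by positivity) (Finset.mem_univ y₀)
        have h4 := Real.log_le_log (by positivity) h3
        rw [Real.log_mul hpos.ne' (Real.exp_pos _).ne', Real.log_exp] at h4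
        refine h1.trans ?_
        have h5 : β * ∫ y, u y ∂(μ.tilted fun y => -β * u y)
            ≤ β * u y₀ - Real.log (μ.real {y₀}) := by
          unfold tiltEntropy at h2
          linarith
        have h6 := (le_div_iff₀' hβ).2 h5
        refine h6.trans (le_of_eq ?_)
        field_simp
        ring
      have hlim : Filter.Tendsto (fun β : ℝ => u y₀ + -Real.log (μ.real {y₀}) * β⁻¹)
          Filter.atTop (nhds (u y₀)) := by
        simpa using (tendsto_inv_atTop_zero.const_mul (-Real.log (μ.real {y₀}))).const_add (u y₀)
      exact ge_of_tendsto hlim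
        ((Filter.eventually_gt_atTop 0).mono key)

end Duality

/-! ### Empirical measures of i.i.d. samples -/

section Sampling

/-- The law of an i.i.d. sequence drawn from `μ`. -/
abbrev iidLaw {Y : Type*} [MeasurableSpace Y] (μ : Measure Y) [IsProbabilityMeasure μ] :
    Measure (ℕ → Y) :=
  Measure.infinitePi fun _ : ℕ => μ

/-- A subsequence of an i.i.d. sequence is again i.i.d. with the same law. -/
lemma measurePreserving_reindex {Y : Type*} [MeasurableSpace Y] (μ : Measure Y)
    [IsProbabilityMeasure μ] {e : ℕ → ℕ} (he : Function.Injective e) :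
    MeasurePreserving (fun (x : ℕ → Y) j => x (e j)) (iidLaw μ) (iidLaw μ) := by
  refine ⟨by fun_prop, ?_⟩
  have h1 : iIndepFun (fun i (x : ℕ → Y) => x i) (iidLaw μ) :=
    iIndepFun_infinitePi (X := fun _ => id) fun _ => measurable_id
  rw [(iIndepFun_iff_map_fun_eq_infinitePi_map fun i => by fun_prop).1 (h1.precomp he)]
  congr 1
  funext j
  exact (measurePreserving_eval_infinitePi (fun _ : ℕ => μ) (e j)).map_eq

variable {Y : Type*} [Fintype Y] [MeasurableSpace Y] [DiscreteMeasurableSpace Y]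
  {μ : Measure Y} [IsProbabilityMeasure μ] {u : Y → ℝ} {δ : ℝ}

lemma isProbabilityMeasure_empirical {Y : Type*} [MeasurableSpace Y] {n : ℕ} (hn : n ≠ 0)
    (x : ℕ → Y) : IsProbabilityMeasure (empirical n x) := by
  constructor
  simp only [empirical, Measure.smul_apply, Measure.finsetSum_apply, measure_univ,
    Finset.sum_const, Finset.card_range, smul_eq_mul, nsmul_eq_mul, mul_one]
  exact ENNReal.inv_mul_cancel (by exact_mod_cast hn) (ENNReal.natCast_ne_top n)

lemma empirical_real_singleton (n : ℕ) (x : ℕ → Y) (y : Y) :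
    (empirical n x).real {y}
      = (n : ℝ)⁻¹ * ∑ j ∈ Finset.range n, ({y} : Set Y).indicator 1 (x j) := by
  rw [measureReal_def, empirical, Measure.smul_apply, Measure.finsetSum_apply, smul_eq_mul,
    ENNReal.toReal_mul, ENNReal.toReal_sum (fun _ _ => measure_ne_top _ _)]
  congr 1
  · simp
  · refine Finset.sum_congr rfl fun j _ => ?_
    rw [Measure.dirac_apply]
    by_cases h : x j = y <;> simp [h]

lemma empirical_singleton_eq_zero {n : ℕ} {x : ℕ → Y} {y : Y} (h : ∀ j, x j ≠ y) :
    empirical n x {y} = 0 := by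
  simp [empirical, h]

lemma measurable_dualValue_empirical (n : ℕ) :
    Measurable fun x : ℕ → Y => dualValue δ (empirical n x) u := by
  let Φ : (Fin n → Y) → ℝ := fun z =>
    dualValue δ ((n : ENNReal)⁻¹ • ∑ j : Fin n, Measure.dirac (z j)) u
  have hΦ : Measurable Φ := measurable_of_finite Φ
  have heq : (fun x : ℕ → Y => dualValue δ (empirical n x) u) = fun x => Φ fun j => x j := by
    funext x
    simp only [Φ, empirical, Finset.sum_range]
  rw [heq]
  exact hΦ.comp (by fun_prop)

lemma exists_abs_dualValue_empirical_le (hδ : 0 ≤ δ) (u : Y → ℝ) :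
    ∃ B : ℝ, ∀ n ≠ 0, ∀ x : ℕ → Y, |dualValue δ (empirical n x) u| ≤ B := by
  obtain ⟨M, hM⟩ := (Set.finite_range u).bddAbove
  obtain ⟨m, hm⟩ := (Set.finite_range u).bddBelow
  refine ⟨max |m| |M|, fun n hn x => ?_⟩
  have := isProbabilityMeasure_empirical hn x
  exact abs_le_max_abs_abs (le_dualValue_of_le hδ fun y => hm ⟨y, rfl⟩)
    (dualValue_le_of_le hδ fun y => hM ⟨y, rfl⟩)

lemma integrable_dualValue_empirical (hδ : 0 ≤ δ) {n : ℕ} (hn : n ≠ 0) :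
    Integrable (fun x : ℕ → Y => dualValue δ (empirical n x) u) (iidLaw μ) := by
  obtain ⟨B, hB⟩ := exists_abs_dualValue_empirical_le hδ u
  exact Integrable.of_bound (measurable_dualValue_empirical n).aestronglyMeasurable B
    (.of_forall fun x => hB n hn x)

/-- The empirical frequency of a point has mean absolute error at most `1 / √n`, by the variance
bound and `|z| ≤ (√n z² + 1/√n) / 2`. -/
lemma integral_abs_empirical_sub_le (y : Y) {n : ℕ} (hn : n ≠ 0) :
    Integrable (fun x : ℕ → Y => |(empirical n x).real {y} - μ.real {y}|) (iidLaw μ) ∧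
    ∫ x, |(empirical n x).real {y} - μ.real {y}| ∂(iidLaw μ) ≤ 1 / √n := by
  have hn0 : (0 : ℝ) < n := by exact_mod_cast Nat.pos_of_ne_zero hn
  set X : ℕ → (ℕ → Y) → ℝ := fun j x => ({y} : Set Y).indicator 1 (x j) with hX
  have hXm : ∀ j, Measurable (X j) := fun j =>
    (measurable_of_finite (({y} : Set Y).indicator (1 : Y → ℝ))).comp (measurable_pi_apply j)
  have hX01 : ∀ j x, X j x ∈ Set.Icc (0 : ℝ) 1 := by
    intro j x
    by_cases h : x j = y <;> simp [hX, h]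
  have hXL : ∀ j, MemLp (X j) 2 (iidLaw μ) := fun j =>
    MemLp.of_bound (hXm j).aestronglyMeasurable 1 (.of_forall fun x => by
      rw [Real.norm_eq_abs, abs_of_nonneg (hX01 j x).1]
      exact (hX01 j x).2)
  have hind : iIndepFun X (iidLaw μ) :=
    iIndepFun_infinitePi (X := fun _ => ({y} : Set Y).indicator (1 : Y → ℝ))
      fun _ => measurable_of_finite _
  have hmean : ∀ j, ∫ x, X j x ∂(iidLaw μ) = μ.real {y} := by
    intro j
    have h1 := (measurePreserving_eval_infinitePi (fun _ : ℕ => μ) j).hasLaw.integral_comp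
      (f := ({y} : Set Y).indicator (1 : Y → ℝ)) (measurable_of_finite _).aestronglyMeasurable
    rw [integral_indicator_one (measurableSet_singleton y)] at h1
    exact h1
  set T : (ℕ → Y) → ℝ := ∑ j ∈ Finset.range n, X j with hT
  have hTL : MemLp T 2 (iidLaw μ) := memLp_finsetSum' _ fun j _ => hXL j
  have hTmean : ∫ x, T x ∂(iidLaw μ) = n * μ.real {y} := by
    simp only [hT, Finset.sum_apply]
    rw [integral_finsetSum _ fun j _ => (hXL j).integrable (by norm_num)]
    simp [hmean]
  have hvar : ∫ x, (T x - n * μ.real {y}) ^ 2 ∂(iidLaw μ) ≤ n := by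
    have h1 := variance_eq_integral (μ := iidLaw μ) hTL.aestronglyMeasurable.aemeasurable
    rw [hTmean] at h1
    rw [← h1, hT, IndepFun.variance_sum (fun j _ => hXL j)
      fun i _ j _ hij => hind.indepFun hij]
    have h2 : ∀ j ∈ Finset.range n, Var[X j; iidLaw μ] ≤ 1 := fun j _ =>
      (variance_le_sq_of_bounded (.of_forall (hX01 j)) (hXm j).aemeasurable).trans (by norm_num)
    simpa using Finset.sum_le_sum h2
  have hemp : ∀ x, (empirical n x).real {y} - μ.real {y} = (n : ℝ)⁻¹ * (T x - n * μ.real {y}) := by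
    intro x
    rw [empirical_real_singleton, mul_sub, inv_mul_cancel_left₀ hn0.ne', hT, Finset.sum_apply]
  have hZ : MemLp (fun x => T x - n * μ.real {y}) 2 (iidLaw μ) := hTL.sub (memLp_const _)
  have hs : (0 : ℝ) < √n := Real.sqrt_pos.2 hn0
  have hss : √(n : ℝ) * √n = n := Real.mul_self_sqrt hn0.le
  simp_rw [hemp]
  refine ⟨((hZ.integrable (by norm_num)).const_mul _).abs, ?_⟩
  have hpt : ∀ x, |(n : ℝ)⁻¹ * (T x - n * μ.real {y})|
      ≤ (√n * ((n : ℝ)⁻¹ ^ 2)) / 2 * (T x - n * μ.real {y}) ^ 2 + 1 / (2 * √n) := by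
    intro x
    set z := (n : ℝ)⁻¹ * (T x - n * μ.real {y}) with hz
    have h1 : (√n * ((n : ℝ)⁻¹ ^ 2)) / 2 * (T x - n * μ.real {y}) ^ 2 = √n / 2 * |z| ^ 2 := by
      rw [sq_abs, hz]
      ring
    rw [h1]
    have h2 : √n / 2 * |z| ^ 2 + 1 / (2 * √n) - |z| = (√n * |z| - 1) ^ 2 / (2 * √n) := by
      field_simp
      ring
    have h3 : 0 ≤ (√n * |z| - 1) ^ 2 / (2 * √n) := by positivity
    linarith
  calc ∫ x, |(n : ℝ)⁻¹ * (T x - n * μ.real {y})| ∂(iidLaw μ)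
      ≤ ∫ x, ((√n * ((n : ℝ)⁻¹ ^ 2)) / 2 * (T x - n * μ.real {y}) ^ 2 + 1 / (2 * √n))
          ∂(iidLaw μ) :=
        integral_mono ((hZ.integrable (by norm_num)).const_mul _).abs
          ((hZ.integrable_sq.const_mul _).add (integrable_const _)) hpt
    _ = (√n * ((n : ℝ)⁻¹ ^ 2)) / 2 * ∫ x, (T x - n * μ.real {y}) ^ 2 ∂(iidLaw μ)
          + 1 / (2 * √n) := by
        rw [integral_add (hZ.integrable_sq.const_mul _) (integrable_const _), integral_const_mul]
        simp
    _ ≤ (√n * ((n : ℝ)⁻¹ ^ 2)) / 2 * n + 1 / (2 * √n) := by gcongr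
    _ = 1 / √n := by
        have h4 : √(n : ℝ) * (n : ℝ)⁻¹ ^ 2 / 2 * n = √n * (√(n : ℝ) * √n)⁻¹ / 2 := by
          rw [hss]
          field_simp
        rw [h4]
        field_simp
        norm_num

lemma ae_iidLaw_support {Y : Type*} [Fintype Y] [MeasurableSpace Y] {μ : Measure Y}
    [IsProbabilityMeasure μ] : ∀ᵐ x ∂(iidLaw μ), ∀ j, μ {x j} ≠ 0 := by
  rw [ae_all_iff]
  intro j
  have h : ∀ᵐ y ∂μ, μ {y} ≠ 0 := by
    rw [ae_iff, measure_null_iff_singleton (Set.to_countable _)]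
    intro y hy
    simpa using hy
  exact (measurePreserving_eval_infinitePi (fun _ : ℕ => μ) j).quasiMeasurePreserving.ae h

lemma exists_pos_le_mass {Y : Type*} [Fintype Y] [MeasurableSpace Y] (μ : Measure Y)
    [IsProbabilityMeasure μ] :
    ∃ c : ℝ, 0 < c ∧ ∀ y, μ {y} ≠ 0 → c ≤ μ.real {y} := by
  obtain ⟨y, hy, -, hmin⟩ := exists_essInf_eq μ fun y => μ.real {y}
  exact ⟨μ.real {y}, ENNReal.toReal_pos hy (measure_ne_top _ _), hmin⟩

/-- The empirical dual value converges in mean at rate `n^(-1/2)`. -/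
lemma exists_integral_abs_dualValue_empirical_sub_le (hδ : 0 < δ) (u : Y → ℝ) :
    ∃ C : ℝ, ∀ n ≠ 0,
      ∫ x, |dualValue δ (empirical n x) u - dualValue δ μ u| ∂(iidLaw μ) ≤ C / √n := by
  obtain ⟨M, hM⟩ := (Set.finite_range u).bddAbove
  obtain ⟨m, hm⟩ := (Set.finite_range u).bddBelow
  obtain ⟨c, hc, hcμ⟩ := exists_pos_le_mass μ
  obtain ⟨y₀, -⟩ := exists_essInf_eq μ u
  have hm' : ∀ y, m ≤ u y := fun y => hm ⟨y, rfl⟩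
  have hM' : ∀ y, u y ≤ M := fun y => hM ⟨y, rfl⟩
  have hosc : 0 ≤ M - m := sub_nonneg.2 ((hm' y₀).trans (hM' y₀))
  set K := 2 * (M - m) / c + 2 * (M - m) / (δ * c) with hK
  have hK0 : 0 ≤ K := by positivity
  refine ⟨K * Fintype.card Y, fun n hn => ?_⟩
  have hI := fun y => integral_abs_empirical_sub_le (μ := μ) y hn
  have hS : Integrable (fun x : ℕ → Y => ∑ y, |(empirical n x).real {y} - μ.real {y}|) (iidLaw μ) :=
    integrable_finsetSum _ fun y _ => (hI y).1
  calc ∫ x, |dualValue δ (empirical n x) u - dualValue δ μ u| ∂(iidLaw μ)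
      ≤ ∫ x, K * ∑ y, |(empirical n x).real {y} - μ.real {y}| ∂(iidLaw μ) := by
        refine integral_mono_ae
          ((integrable_dualValue_empirical hδ.le hn).sub (integrable_const _)).abs
          (hS.const_mul K) ?_
        filter_upwards [ae_iidLaw_support (μ := μ)] with x hx
        have := isProbabilityMeasure_empirical hn x
        refine abs_dualValue_sub_le hδ hm' hM' hc hcμ fun y hy => ?_
        refine empirical_singleton_eq_zero fun j hj => hx j ?_
        rw [hj, hy]
    _ = K * ∑ y, ∫ x, |(empirical n x).real {y} - μ.real {y}| ∂(iidLaw μ) := by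
        rw [integral_const_mul, integral_finsetSum _ fun y _ => (hI y).1]
    _ ≤ K * ∑ _y : Y, 1 / √n := by
        gcongr with y
        exact (hI y).2
    _ = K * Fintype.card Y / √n := by
        simp
        ring

end Sampling

/-! ### Telescoping over the levels -/

section Levels

variable {Y : Type*} [Fintype Y] [MeasurableSpace Y] [DiscreteMeasurableSpace Y]
  {μ : Measure Y} [IsProbabilityMeasure μ] {u : Y → ℝ} {δ : ℝ}

/-- Evaluating on a subsequence preserves integrability and integrals. -/
lemma integrable_integral_reindex {Y : Type*} [MeasurableSpace Y] {μ : Measure Y}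
    [IsProbabilityMeasure μ] {F : (ℕ → Y) → ℝ} (hF : Integrable F (iidLaw μ)) {e : ℕ → ℕ}
    (he : Function.Injective e) :
    Integrable (fun x : ℕ → Y => F fun j => x (e j)) (iidLaw μ) ∧
    ∫ x : ℕ → Y, F (fun j => x (e j)) ∂(iidLaw μ) = ∫ x, F x ∂(iidLaw μ) := by
  have h := measurePreserving_reindex μ he
  exact ⟨(h.integrable_comp hF.aestronglyMeasurable).2 hF,
    h.hasLaw.integral_comp hF.aestronglyMeasurable⟩

lemma injective_two_mul : Function.Injective fun j : ℕ => 2 * j := fun a b h => by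
  simpa using h

lemma injective_two_mul_add_one : Function.Injective fun j : ℕ => 2 * j + 1 := fun a b h => by
  simpa using h

lemma measurable_levelDiff (n : ℕ) : Measurable (levelDiff (Y := Y) δ u n) := by
  unfold levelDiff
  have h1 := (measurable_dualValue_empirical (δ := δ) (u := u) (2 ^ n)).comp
    (show Measurable fun (x : ℕ → Y) j => x (2 * j) by fun_prop)
  have h2 := (measurable_dualValue_empirical (δ := δ) (u := u) (2 ^ n)).comp
    (show Measurable fun (x : ℕ → Y) j => x (2 * j + 1) by fun_prop)
  exact ((measurable_dualValue_empirical _).sub (h2.const_mul _)).sub (h1.const_mul _)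

lemma integrable_levelDiff (hδ : 0 ≤ δ) (n : ℕ) :
    Integrable (levelDiff δ u n) (iidLaw μ) := by
  have h : Integrable (fun x : ℕ → Y => dualValue δ (empirical (2 ^ n) x) u) (iidLaw μ) :=
    integrable_dualValue_empirical hδ (by positivity)
  exact ((integrable_dualValue_empirical hδ (by positivity)).sub
    ((integrable_integral_reindex h injective_two_mul_add_one).1.const_mul _)).sub
    ((integrable_integral_reindex h injective_two_mul).1.const_mul _)

/-- In mean the level differences telescope. -/
lemma integral_levelDiff (hδ : 0 ≤ δ) (n : ℕ) :
    ∫ x, levelDiff δ u n x ∂(iidLaw μ)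
      = ∫ x, dualValue δ (empirical (2 ^ (n + 1)) x) u ∂(iidLaw μ)
        - ∫ x, dualValue δ (empirical (2 ^ n) x) u ∂(iidLaw μ) := by
  have h : Integrable (fun x : ℕ → Y => dualValue δ (empirical (2 ^ n) x) u) (iidLaw μ) :=
    integrable_dualValue_empirical hδ (by positivity)
  have h0 : Integrable (fun x : ℕ → Y => dualValue δ (empirical (2 ^ (n + 1)) x) u) (iidLaw μ) :=
    integrable_dualValue_empirical hδ (by positivity)
  obtain ⟨i1, e1⟩ := integrable_integral_reindex h injective_two_mul_add_one
  obtain ⟨i2, e2⟩ := integrable_integral_reindex h injective_two_mul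
  unfold levelDiff
  refine (integral_sub (h0.sub (i1.const_mul (1 / 2))) (i2.const_mul (1 / 2))).trans ?_
  rw [integral_sub' h0 (i1.const_mul (1 / 2)), integral_const_mul, integral_const_mul, e1, e2]
  ring

lemma sqrt_two_pow (n : ℕ) : √((2 ^ n : ℕ) : ℝ) = √2 ^ n := by
  rw [Nat.cast_pow, Real.sqrt_eq_iff_mul_self_eq (by positivity) (by positivity), ← mul_pow,
    Real.mul_self_sqrt (by norm_num)]
  norm_num

lemma summable_div_sqrt_two_pow (C : ℝ) : Summable fun n : ℕ => C / √2 ^ n := by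
  have h : (√2)⁻¹ < 1 := inv_lt_one_of_one_lt₀ (by
    rw [Real.lt_sqrt (by norm_num)]
    norm_num)
  have := (summable_geometric_of_lt_one (by positivity) h).mul_left C
  simpa [div_eq_mul_inv] using this

lemma exists_integral_abs_levelDiff_le (hδ : 0 < δ) (u : Y → ℝ) :
    ∃ C : ℝ, ∀ n, ∫ x, |levelDiff δ u n x| ∂(iidLaw μ) ≤ C / √2 ^ n := by
  obtain ⟨C, hC⟩ := exists_integral_abs_dualValue_empirical_sub_le (μ := μ) hδ u
  have hC0 : 0 ≤ C := by
    have := (integral_nonneg fun _ => abs_nonneg _).trans (hC 1 one_ne_zero)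
    simpa using this
  refine ⟨2 * C, fun n => ?_⟩
  set F := dualValue δ μ u with hF
  let G : ℕ → (ℕ → Y) → ℝ := fun k x => |dualValue δ (empirical (2 ^ k) x) u - F|
  have hG : ∀ k, Integrable (G k) (iidLaw μ) := fun k =>
    ((integrable_dualValue_empirical hδ.le (by positivity)).sub (integrable_const _)).abs
  have hGC : ∀ k, ∫ x, G k x ∂(iidLaw μ) ≤ C / √2 ^ k := fun k =>
    sqrt_two_pow k ▸ hC (2 ^ k) (by positivity)
  obtain ⟨i1, e1⟩ := integrable_integral_reindex (hG n) injective_two_mul_add_one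
  obtain ⟨i2, e2⟩ := integrable_integral_reindex (hG n) injective_two_mul
  have hpt : ∀ x : ℕ → Y, |levelDiff δ u n x|
      ≤ G (n + 1) x + 1 / 2 * G n (fun j => x (2 * j + 1)) + 1 / 2 * G n (fun j => x (2 * j)) := by
    intro x
    simp only [levelDiff, G]
    set a := dualValue δ (empirical (2 ^ (n + 1)) x) u
    set b := dualValue δ (empirical (2 ^ n) fun j => x (2 * j + 1)) u
    set c := dualValue δ (empirical (2 ^ n) fun j => x (2 * j)) u
    have h1 := le_abs_self (a - F)
    have h2 := le_abs_self (b - F)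
    have h3 := le_abs_self (c - F)
    have h4 := neg_abs_le (a - F)
    have h5 := neg_abs_le (b - F)
    have h6 := neg_abs_le (c - F)
    rw [abs_le]
    constructor <;> linarith
  have hmono := integral_mono (integrable_levelDiff (μ := μ) (u := u) hδ.le n).abs
    (((hG (n + 1)).add (i1.const_mul (1 / 2))).add (i2.const_mul (1 / 2))) hpt
  refine hmono.trans ?_
  rw [integral_add' ((hG (n + 1)).add (i1.const_mul (1 / 2))) (i2.const_mul (1 / 2)),
    integral_add' (hG (n + 1)) (i1.const_mul (1 / 2)), integral_const_mul, integral_const_mul,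
    e1, e2]
  have h1 := hGC n
  have h2 := hGC (n + 1)
  have h3 : C / √2 ^ (n + 1) ≤ C / √2 ^ n := by
    have : (1 : ℝ) ≤ √2 := Real.one_le_sqrt.2 (by norm_num)
    exact div_le_div_of_nonneg_left hC0 (by positivity) (pow_le_pow_right₀ this n.le_succ)
  have h4 : 2 * C / √2 ^ n = C / √2 ^ n + C / √2 ^ n := by ring
  rw [h4]
  linarith

lemma summable_integral_abs_levelDiff (hδ : 0 < δ) (u : Y → ℝ) :
    Summable fun n => ∫ x, |levelDiff δ u n x| ∂(iidLaw μ) := by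
  obtain ⟨C, hC⟩ := exists_integral_abs_levelDiff_le (μ := μ) hδ u
  exact (summable_div_sqrt_two_pow C).of_nonneg_of_le
    (fun n => integral_nonneg fun _ => abs_nonneg _) hC

lemma integral_apply_zero (u : Y → ℝ) :
    Integrable (fun x : ℕ → Y => u (x 0)) (iidLaw μ) ∧
      ∫ x, u (x 0) ∂(iidLaw μ) = ∫ y, u y ∂μ := by
  have h := measurePreserving_eval_infinitePi (fun _ : ℕ => μ) 0
  have hu : Integrable u μ := .of_finite
  exact ⟨(h.integrable_comp hu.aestronglyMeasurable).2 hu,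
    h.hasLaw.integral_comp hu.aestronglyMeasurable⟩

/-- The mean level differences sum to the bias of the one-sample estimate. -/
lemma hasSum_integral_levelDiff (hδ : 0 < δ) (u : Y → ℝ) :
    HasSum (fun n => ∫ x, levelDiff δ u n x ∂(iidLaw μ)) (dualValue δ μ u - ∫ y, u y ∂μ) := by
  have hsum : Summable fun n => ∫ x, levelDiff δ u n x ∂(iidLaw μ) :=
    (summable_integral_abs_levelDiff hδ u).of_norm_bounded fun n => norm_integral_le_integral_norm _
  have hzero : ∫ x, dualValue δ (empirical (2 ^ 0) x) u ∂(iidLaw μ) = ∫ y, u y ∂μ := by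
    rw [← (integral_apply_zero u).2]
    refine integral_congr_ae (.of_forall fun x => ?_)
    simp [empirical, dualValue_dirac hδ.le]
  have hlim : Filter.Tendsto (fun n => ∫ x, dualValue δ (empirical (2 ^ n) x) u ∂(iidLaw μ))
      Filter.atTop (nhds (dualValue δ μ u)) := by
    obtain ⟨C, hC⟩ := exists_integral_abs_dualValue_empirical_sub_le (μ := μ) hδ u
    rw [tendsto_iff_norm_sub_tendsto_zero]
    refine squeeze_zero (fun _ => norm_nonneg _) (fun n => ?_)
      (summable_div_sqrt_two_pow C).tendsto_atTop_zero
    have h0 : Integrable (fun x : ℕ → Y => dualValue δ (empirical (2 ^ n) x) u) (iidLaw μ) :=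
      integrable_dualValue_empirical hδ.le (by positivity)
    have h1 : ∫ x, dualValue δ (empirical (2 ^ n) x) u ∂(iidLaw μ) - dualValue δ μ u
        = ∫ x, (dualValue δ (empirical (2 ^ n) x) u - dualValue δ μ u) ∂(iidLaw μ) := by
      rw [integral_sub h0 (integrable_const _)]
      simp
    rw [h1]
    exact (norm_integral_le_integral_norm _).trans (sqrt_two_pow n ▸ hC (2 ^ n) (by positivity))
  refine (hsum.hasSum_iff_tendsto_nat).2 ?_
  simp_rw [integral_levelDiff hδ.le, Finset.sum_range_sub
    (fun n => ∫ x, dualValue δ (empirical (2 ^ n) x) u ∂(iidLaw μ)), hzero]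
  exact hlim.sub_const _

/-- Randomizing the level with the inverse weight turns the telescoping series into an
expectation. -/
theorem integrable_integral_mlmc (hδ : 0 < δ) (u : Y → ℝ) (g : unitInterval)
    (hg0 : 0 < (g : ℝ)) (hg1 : (g : ℝ) < 1) :
    Integrable (fun z : ℕ × (ℕ → Y) => mlmc δ g u z.1 z.2) ((geometricMeasure g).prod (iidLaw μ)) ∧
    ∫ z, mlmc δ g u z.1 z.2 ∂((geometricMeasure g).prod (iidLaw μ)) = dualValue δ μ u := by
  have hg : g ≠ 0 := by
    rintro rfl
    simp at hg0
  have hw : ∀ n, 0 < geoWeight g n := fun n => mul_pos hg0 (pow_pos (by linarith) n)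
  have hgw : ∀ n, (1 - (g : ℝ)) ^ n * g = geoWeight g n := fun n => mul_comm _ _
  let R : ℕ × (ℕ → Y) → ℝ := fun z => levelDiff δ u z.1 z.2 / geoWeight g z.1
  have hRm : Measurable R := measurable_from_prod_countable_right fun n =>
    show Measurable fun x => levelDiff δ u n x / geoWeight g n from
      (measurable_levelDiff n).div_const _
  have hnorm : ∀ n, ∫ x, ‖R (n, x)‖ ∂(iidLaw μ)
      = (∫ x, |levelDiff δ u n x| ∂(iidLaw μ)) / geoWeight g n := by
    intro n
    rw [← integral_div]
    refine integral_congr_ae (.of_forall fun x => ?_)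
    simp only [R, Real.norm_eq_abs, abs_div, abs_of_pos (hw n)]
  have hR : Integrable R ((geometricMeasure g).prod (iidLaw μ)) := by
    rw [integrable_prod_iff hRm.aestronglyMeasurable]
    refine ⟨.of_forall fun n => (integrable_levelDiff hδ.le n).div_const (geoWeight g n), ?_⟩
    rw [integrable_geometricMeasure_iff hg]
    refine (summable_integral_abs_levelDiff (μ := μ) hδ u).congr fun n => ?_
    have h1 : 0 ≤ ∫ x, |levelDiff δ u n x| ∂(iidLaw μ) := integral_nonneg fun _ => abs_nonneg _
    rw [hgw, hnorm, Real.norm_eq_abs, abs_of_nonneg (div_nonneg h1 (hw n).le),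
      mul_div_cancel₀ _ (hw n).ne']
  have hRint : ∫ z, R z ∂((geometricMeasure g).prod (iidLaw μ))
      = dualValue δ μ u - ∫ y, u y ∂μ := by
    rw [integral_prod _ hR, integral_geometricMeasure hg,
      ← (hasSum_integral_levelDiff (μ := μ) hδ u).tsum_eq]
    refine tsum_congr fun n => ?_
    simp only [R]
    rw [integral_div, hgw, smul_eq_mul, mul_div_cancel₀ _ (hw n).ne']
  obtain ⟨hi, he⟩ := integral_apply_zero (μ := μ) u
  have hsnd : MeasurePreserving Prod.snd ((geometricMeasure g).prod (iidLaw μ)) (iidLaw μ) :=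
    measurePreserving_snd
  have hu : Integrable (fun z : ℕ × (ℕ → Y) => u (z.2 0))
      ((geometricMeasure g).prod (iidLaw μ)) := (hsnd.integrable_comp hi.aestronglyMeasurable).2 hi
  have hue : ∫ z : ℕ × (ℕ → Y), u (z.2 0) ∂((geometricMeasure g).prod (iidLaw μ))
      = ∫ y, u y ∂μ := (hsnd.hasLaw.integral_comp hi.aestronglyMeasurable).trans he
  refine ⟨hu.add hR, ?_⟩
  refine (integral_add hu hR).trans ?_
  rw [hue, hRint]
  ring

end Levels

/-! ### The Bellman operator and its estimator -/

namespace MDP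

variable {S A : Type*}

lemma hasLaw_reward_drawLaw [MeasurableSpace S] (M : MDP S A) (g : unitInterval) (s : S) (a : A) :
    HasLaw (fun d : M.Draw => (d.1, d.2.2.1))
      ((geometricMeasure g).prod (iidLaw (M.ν s a).toMeasure)) (M.drawLaw g s a) :=
  ((MeasurePreserving.id _).prod (measurePreserving_fst.comp measurePreserving_snd)).hasLaw

lemma hasLaw_state_drawLaw [MeasurableSpace S] (M : MDP S A) (g : unitInterval) (s : S) (a : A) :
    HasLaw (fun d : M.Draw => (d.2.1, d.2.2.2))
      ((geometricMeasure g).prod (iidLaw (M.p s a).toMeasure)) (M.drawLaw g s a) :=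
  (((MeasurePreserving.id _).prod measurePreserving_snd).comp measurePreserving_snd).hasLaw

variable [Fintype S] [MeasurableSpace S] [DiscreteMeasurableSpace S] (M : MDP S A)

/-- The primal and the dual form of the distributionally robust Bellman operator agree. -/
theorem drBellman_eq_drBellmanDual {δ : ℝ} (hδ : 0 < δ) (Q : S × A → ℝ) :
    M.drBellman δ Q = M.drBellmanDual δ Q := by
  funext z
  have hp := isGLB_integral_klBall (μ := (M.p z.1 z.2).toMeasure) (u := greedyValue Q) hδ
  have hν := isGLB_integral_klBall (μ := (M.ν z.1 z.2).toMeasure)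
    (u := fun r : M.rewards => (r : ℝ)) hδ
  unfold drBellman drBellmanDual
  refine IsGLB.csInf_eq ⟨?_, fun b hb => ?_⟩
    ⟨_, _, self_mem_klBall _, _, self_mem_klBall _, rfl⟩
  · rintro _ ⟨q, hq, ρ, hρ, rfl⟩
    exact add_le_add (hν.1 ⟨ρ, hρ, rfl⟩) (mul_le_mul_of_nonneg_left (hp.1 ⟨q, hq, rfl⟩) M.γ_pos.le)
  -- A common lower bound is moved through the two infima one at a time.
  · have h1 : ∀ q ∈ klBall δ (M.p z.1 z.2).toMeasure, b - M.γ * ∫ s', greedyValue Q s' ∂q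
        ≤ dualValue δ (M.ν z.1 z.2).toMeasure fun r : M.rewards => (r : ℝ) := by
      intro q hq
      refine hν.2 ?_
      rintro _ ⟨ρ, hρ, rfl⟩
      have := hb ⟨q, hq, ρ, hρ, rfl⟩
      simp only
      linarith
    have h2 : (b - dualValue δ (M.ν z.1 z.2).toMeasure fun r : M.rewards => (r : ℝ)) / M.γ
        ≤ dualValue δ (M.p z.1 z.2).toMeasure (greedyValue Q) := by
      refine hp.2 ?_
      rintro _ ⟨q, hq, rfl⟩
      have := h1 q hq
      rw [div_le_iff₀' M.γ_pos]
      simp only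
      linarith
    rw [div_le_iff₀' M.γ_pos] at h2
    linarith

/-- Each coordinate of the estimator is integrable with the dual form as its mean. -/
theorem integrable_integral_mlmcEstimator_apply {Ω : Type*} [MeasurableSpace Ω] {P : Measure Ω}
    {D : Ω → S × A → M.Draw} {δ : ℝ} (hδ : 0 < δ) {g : unitInterval} (hg0 : 0 < (g : ℝ))
    (hg1 : (g : ℝ) < 1) (Q : S × A → ℝ) (z : S × A)
    (hD : HasLaw (fun ω => D ω z) (M.drawLaw g z.1 z.2) P) :
    Integrable (fun ω => M.mlmcEstimator δ g Q (D ω) z) P ∧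
      ∫ ω, M.mlmcEstimator δ g Q (D ω) z ∂P = M.drBellmanDual δ Q z := by
  obtain ⟨hi₁, he₁⟩ := integrable_integral_mlmc (μ := (M.ν z.1 z.2).toMeasure) hδ
    (fun r : M.rewards => (r : ℝ)) g hg0 hg1
  obtain ⟨hi₂, he₂⟩ := integrable_integral_mlmc (μ := (M.p z.1 z.2).toMeasure) hδ
    (greedyValue Q) g hg0 hg1
  have hl₁ := (M.hasLaw_reward_drawLaw g z.1 z.2).comp hD
  have hl₂ := (M.hasLaw_state_drawLaw g z.1 z.2).comp hD
  have hj₁ := (hl₁.map_eq.symm ▸ hi₁).comp_aemeasurable hl₁.aemeasurable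
  have hj₂ := (hl₂.map_eq.symm ▸ hi₂).comp_aemeasurable hl₂.aemeasurable
  have hk₁ := (hl₁.integral_comp hi₁.aestronglyMeasurable).trans he₁
  have hk₂ := (hl₂.integral_comp hi₂.aestronglyMeasurable).trans he₂
  refine ⟨hj₁.add (hj₂.const_mul M.γ), ?_⟩
  refine (integral_add hj₁ (hj₂.const_mul M.γ)).trans ?_
  rw [integral_const_mul, hk₁, hk₂, drBellmanDual]

end MDP

end DRQ

end

theorem mainTheorem4 {S A Ω : Type*} [Fintype S] [Nonempty S] [Fintype A] [Nonempty A]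
    [MeasurableSpace S] [DiscreteMeasurableSpace S]
    (M : DRQ.MDP S A) (δ : ℝ) (hδ : 0 < δ)
    (hδM : 1 - Real.exp (-δ) ≤ 1 / 2 * M.minSupportProb)
    (g : unitInterval) (hg0 : 0 < (g : ℝ)) (hg1 : (g : ℝ) < 3 / 4)
    [MeasurableSpace Ω] (P : Measure Ω) [IsProbabilityMeasure P]
    (D : Ω → S × A → M.Draw)
    (hD : ∀ s a, HasLaw (fun ω => D ω (s, a)) (M.drawLaw g s a) P)
    (Q : S × A → ℝ) :
    Integrable (fun ω => M.mlmcEstimator δ g Q (D ω)) P ∧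
      ∫ ω, M.mlmcEstimator δ g Q (D ω) ∂P = M.drBellman δ Q ∧
      ∫ ω, M.mlmcEstimator δ g Q (D ω) ∂P = M.drBellmanDual δ Q ∧
      ∫ ω, M.noise δ g Q (D ω) ∂P = 0 := by
  have hz := fun z : S × A => M.integrable_integral_mlmcEstimator_apply hδ hg0
    (hg1.trans (by norm_num)) Q z (hD z.1 z.2)
  have hint : Integrable (fun ω => M.mlmcEstimator δ g Q (D ω)) P :=
    Integrable.of_eval fun z => (hz z).1
  have hdual : ∫ ω, M.mlmcEstimator δ g Q (D ω) ∂P = M.drBellmanDual δ Q := by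
    funext z
    rw [eval_integral fun z => (hz z).1, (hz z).2]
  have hprimal := hdual.trans (M.drBellman_eq_drBellmanDual hδ Q).symm
  refine ⟨hint, hprimal, hdual, ?_⟩
  unfold DRQ.MDP.noise
  rw [integral_sub hint (integrable_const _), hprimal]
  simp
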